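/- Let $t \ge 3$ be an integer. All graphs are finite and simple. A $t$-clique of a graph $G$ is a set of $t$ pairwise adjacent vertices, and a graph is $K_t$-free if it has no $t$-clique. **The parameter $\mathsf{bed}^+_t$.** A root of a connected graph $G$ is a nonempty set $T \subseteq V(G)$ such that $G[T]$ is connected and $K_t$-free, and every connected component of $G-T$ has exactly one neighbour in $T$. Define $\mathsf{bed}^+_t(G)$ recursively, using the first case that applies: - $\mathsf{bed}^+_t(G) = 0$ if $V(G)=\emptyset$; - $\mathsf{bed}^+_t(G) = \mathsf{bed}^+_t(G-v)$ if $v$ is a vertex of $G$ that lies in no $t$-clique of $G$ (the choice of such a $v$ does not matter); - $\mathsf{bed}^+_t(G) = \max_{i} \mathsf{bed}^+_t(C_i)$ if $G$ has connected components $C_1,\dots,C_c$ with $c \ge 2$; - $\mathsf{bed}^+_t(G) = 1+\min_{T} \mathsf{bed}^+_t(G-T)$ otherwise, where $T$ ranges over the roots of $G$. **Blocking sets.** An instance of Extended $K_t$-Hitting is a pair $(G,\mathcal F)$, where $G$ is a graph and $\mathcal F$ is a set of cliques of $G$, each with at least $1$ and at most $t-1$ vertices. A solution is a set $S\subseteq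 V(G)$ that meets every $t$-clique of $G$ and every member of $\mathcal F$; $\mathsf{opt}(G,\mathcal F)$ is the minimum size of a solution, and $\mathsf{opt}(G)=\mathsf{opt}(G,\emptyset)$. The instance is clean if $\mathsf{opt}(G,\mathcal F)=\mathsf{opt}(G)$. A blocking set of $(G,\mathcal F)$ is a set $\mathcal B$ of cliques of $G$, each with at least $1$ and at most $t-1$ vertices, such that $\mathsf{opt}(G,\mathcal F\cup\mathcal B)>\mathsf{opt}(G,\mathcal F)$. Let $\mathsf{mmbs}_t(G,\mathcal F)$ be the maximum of $|\mathcal B|$ over the inclusion-minimal blocking sets $\mathcal B$ of $(G,\mathcal F)$ (and $0$ if there are none), and let $\mathsf{mmbs}_t(G)$ be the maximum of $\mathsf{mmbs}_t(G,\mathcal F)$ over all clean instances $(G,\mathcal F)$. **The tower.** Let $\beta(0,t)=1$ and $\beta(x,t)=2^{t\,\beta(x-1,t)}$ for $x\ge 1$, so that $\beta(1,t)=2^t$, $\beta(2,t)=2^{t2^t}$, and so on. **Theorem.** For every graph $G$ and every integer $t \ge 3$, $$\mathsf{mmbs}_t(G) \le \beta\bigl(\mathsf{bed}^+_t(G),\,t\bigr).$$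 -/

import Mathlib

/-! Graphs are finite simple graphs `G : SimpleGraph V` with `[Fintype V]`. A copy of `K_t` in `G` is
the same thing as a `t`-clique, that is, a vertex set `K` with `G.IsNClique t K`. For a vertex set
`U`, the induced subgraph `G[U]` is `G.induce (U : Set V)`; the graph `G` itself is `U = univ`. -/

namespace KtHitting

/-! ### Roots and the parameter `bed⁺_t` -/

section Bed

variable {V : Type*}

open Classical in
/-- The vertex set, as a subset of `U`, of a connected component `c` of `G[U]`. -/
noncomputable def compVerts (G : SimpleGraph V) (U : Finset V)
    (c : (G.induce (U : Set V)).ConnectedComponent) : Finset V :=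
  U.filter fun w => ∃ h : w ∈ (U : Set V), (G.induce (U : Set V)).connectedComponentMk ⟨w, h⟩ = c

/-- `v` is a vertex of `G[U]` that lies in no copy of `K_t` in `G[U]`. -/
def IsNonKtVertex (G : SimpleGraph V) (t : ℕ) (U : Finset V) (v : V) : Prop :=
  v ∈ U ∧ ∀ K : Finset V, K ⊆ U → G.IsNClique t K → v ∉ K

open Classical in
/-- `T` is a root of the (connected) graph `G[U]`, for `H = K_t`: `T` is a nonempty set of vertices,
`G[T]` is connected and `K_t`-free, and every connected component of `G[U] - T` has exactly one
neighbour in `T`. -/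
structure IsRoot (G : SimpleGraph V) (t : ℕ) (U T : Finset V) : Prop where
  subset : T ⊆ U
  nonempty : T.Nonempty
  connected : (G.induce (T : Set V)).Connected
  cliqueFree : (G.induce (T : Set V)).CliqueFree t
  one_neighbor :
    ∀ c : (G.induce ((U \ T : Finset V) : Set V)).ConnectedComponent,
      (T.filter fun x => ∃ w ∈ compVerts G (U \ T) c, G.Adj w x).card = 1

open Classical in
theorem compVerts_ssubset (G : SimpleGraph V) (U : Finset V) (hU : U.Nonempty)
    (h : ¬ (G.induce (U : Set V)).Connected)
    (c : (G.induce (U : Set V)).ConnectedComponent) : compVerts G U c ⊂ U := by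
  refine (Finset.filter_subset _ _).ssubset_of_ne fun heq => h ?_
  have key : ∀ x : (U : Set V), (G.induce (U : Set V)).connectedComponentMk x = c := by
    intro x
    have hx : (x : V) ∈ compVerts G U c := by
      unfold compVerts
      rw [heq]
      exact x.2
    obtain ⟨_, hc⟩ := (Finset.mem_filter.mp hx).2
    exact hc
  obtain ⟨u, hu⟩ := hU
  have : Nonempty (U : Set V) := ⟨⟨u, hu⟩⟩
  exact ⟨fun x y => SimpleGraph.ConnectedComponent.exact ((key x).trans (key y).symm)⟩

open Classical in
/-- The parameter `bed⁺_t` of the induced subgraph `G[U]`: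
* it is `0` if `U = ∅`;
* it is `bed⁺_t (G[U] - v)` if `v` is a vertex of `G[U]` in no copy of `K_t` (any choice of `v` gives
  the same value, see `bedPlusOn_erase`);
* it is the maximum over the connected components of `G[U]` if there are at least two of them;
* otherwise it is `1 + min_T bed⁺_t (G[U] - T)`, where `T` ranges over the roots of `G[U]`.

(The single vertices are roots as soon as `t ≥ 2`, so the minimum is over a nonempty set.) -/
noncomputable def bedPlusOn (G : SimpleGraph V) (t : ℕ) (U : Finset V) : ℕ :=
  if hU : U = ∅ then 0
  else if hv : ∃ v, IsNonKtVertex G t U v then bedPlusOn G t (U.erase hv.choose)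
  else if hc : ¬ (G.induce (U : Set V)).Connected then
    Finset.univ.sup fun c : (G.induce (U : Set V)).ConnectedComponent =>
      bedPlusOn G t (compVerts G U c)
  else 1 + ⨅ T : {T : Finset V // IsRoot G t U T}, bedPlusOn G t (U \ T.1)
termination_by U.card
decreasing_by
  · exact Finset.card_erase_lt_of_mem hv.choose_spec.1
  · exact Finset.card_lt_card
      (compVerts_ssubset G U (Finset.nonempty_iff_ne_empty.mpr hU) hc c)
  · exact Finset.card_lt_card (Finset.sdiff_ssubset T.2.subset T.2.nonempty)

open Classical in
/-- The second case in the definition of `bed⁺_t` does not depend on the chosen vertex. -/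
theorem bedPlusOn_erase (G : SimpleGraph V) (t : ℕ) (U : Finset V) (v : V)
    (hv : IsNonKtVertex G t U v) : bedPlusOn G t U = bedPlusOn G t (U.erase v) := by
  induction hn : U.card using Nat.strong_induction_on generalizing U v with
  | _ n ih =>
    have hne : U ≠ ∅ := Finset.ne_empty_of_mem hv.1
    have hex : ∃ v, IsNonKtVertex G t U v := ⟨v, hv⟩
    have hw := hex.choose_spec
    have step : bedPlusOn G t U = bedPlusOn G t (U.erase hex.choose) := by
      rw [bedPlusOn, dif_neg hne, dif_pos hex]
    rw [step]
    generalize hex.choose = w at hw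
    by_cases hvw : v = w
    · rw [hvw]
    have mono : ∀ a b, IsNonKtVertex G t U a → a ≠ b → IsNonKtVertex G t (U.erase b) a :=
      fun a b ha hab => ⟨Finset.mem_erase.mpr ⟨hab, ha.1⟩,
        fun K hK => ha.2 K (hK.trans (Finset.erase_subset _ _))⟩
    rw [ih _ (hn ▸ Finset.card_erase_lt_of_mem hw.1) (U.erase w) v (mono v w hv hvw) rfl,
      ih _ (hn ▸ Finset.card_erase_lt_of_mem hv.1) (U.erase v) w (mono w v hw (Ne.symm hvw)) rfl,
      Finset.erase_right_comm]

/-- `bed⁺_t(G)`. -/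
noncomputable def bedPlus [Fintype V] (G : SimpleGraph V) (t : ℕ) : ℕ :=
  bedPlusOn G t Finset.univ

end Bed

/-! ### Extended `K_t`-hitting and blocking sets -/

section Blocking

variable {V : Type*}

/-- `F` is a set of cliques of `G`, each with at least `1` and at most `t - 1` vertices. This is the
condition on the second component of an instance `(G, F)` of Extended `K_t`-Hitting, and also the
first condition on a blocking set. -/
def IsSmallCliqueFamily (G : SimpleGraph V) (t : ℕ) (F : Finset (Finset V)) : Prop :=
  ∀ Z ∈ F, 1 ≤ Z.card ∧ Z.card ≤ t - 1 ∧ G.IsClique (Z : Set V)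

/-- `S` is a solution of `(G, F)`: it meets every `t`-clique of `G` and every member of `F`. -/
def IsSolution (G : SimpleGraph V) (t : ℕ) (F : Finset (Finset V)) (S : Finset V) : Prop :=
  (∀ K : Finset V, G.IsNClique t K → ∃ v ∈ K, v ∈ S) ∧ ∀ Z ∈ F, ∃ v ∈ Z, v ∈ S

/-- `opt_t(G, F)`, the minimum size of a solution of `(G, F)`. For `1 ≤ t` and `∅ ∉ F` (so for every
instance) there is a solution, namely the set of all vertices. -/
noncomputable def opt (G : SimpleGraph V) (t : ℕ) (F : Finset (Finset V)) : ℕ :=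
  sInf {n | ∃ S : Finset V, IsSolution G t F S ∧ S.card = n}

/-- `(G, F)` is a clean instance of Extended `K_t`-Hitting: an instance with
`opt_t(G, F) = opt_t(G)`. -/
def IsCleanInstance (G : SimpleGraph V) (t : ℕ) (F : Finset (Finset V)) : Prop :=
  IsSmallCliqueFamily G t F ∧ opt G t F = opt G t ∅

open Classical in
/-- `B` is a blocking set of `(G, F)`. -/
def IsBlockingSet (G : SimpleGraph V) (t : ℕ) (F B : Finset (Finset V)) : Prop :=
  IsSmallCliqueFamily G t B ∧ opt G t F < opt G t (F ∪ B)

open Classical in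
/-- `B` is an inclusion-minimal blocking set of `(G, F)`. -/
def IsMinimalBlockingSet (G : SimpleGraph V) (t : ℕ) (F B : Finset (Finset V)) : Prop :=
  IsBlockingSet G t F B ∧ ∀ Z ∈ B, ¬ IsBlockingSet G t F (B.erase Z)

open Classical in
/-- `mmbs_t(G, F)`, the maximum size of an inclusion-minimal blocking set of `(G, F)`. (A graph without
vertices has no blocking set; the maximum is then `0`.) -/
noncomputable def mmbsInstance [Fintype V] (G : SimpleGraph V) (t : ℕ)
    (F : Finset (Finset V)) : ℕ :=
  (Finset.univ.filter fun B : Finset (Finset V) => IsMinimalBlockingSet G t F B).sup Finset.card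

open Classical in
/-- `mmbs_t(G)`, the maximum of `mmbs_t(G, F)` over the clean instances `(G, F)`. -/
noncomputable def mmbs [Fintype V] (G : SimpleGraph V) (t : ℕ) : ℕ :=
  (Finset.univ.filter fun F : Finset (Finset V) => IsCleanInstance G t F).sup
    fun F => mmbsInstance G t F

end Blocking

/-- The tower `2^(t 2^(t 2^(⋯^t)))` with `x` twos:
`β(0, t) = 1`, `β(1, t) = 2^t`, `β(2, t) = 2^(t 2^t)`, and so on. -/
def beta : ℕ → ℕ → ℕ
  | 0, _ => 1
  | x + 1, t => 2 ^ (t * beta x t)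

end KtHitting

/-! The bound is a Helly number: if no minimum `K_t`-hitting set meets every member of a family of
small cliques, then some bounded subfamily already has this property. Applied to `F ∪ B` with `(G,
F)` clean, such a subfamily must contain every member of a minimal blocking set `B`; this is
`mmbs_le_of_helly`. The Helly number is bounded by following the recursion for `bed⁺_t`. The claim
is made for all `W ⊆ U`, because the argument deletes further vertices. Small cliques may be empty,
because deleting a vertex may empty them. The main step is a root `T` (`IsRoot.helly`). Each vertex
outside `T` is assigned to the unique neighbour in `T` of its component, so `W` splits into fibres.
As `T` is `K_t`-free, every `t`-clique lies in one fibre, and the optimum is the sum of the fibre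
optima. By `helly_of_fibers`, either a single fibre is the obstruction, or a clique `Z ⊆ T` is, no
vertex of which can belong to a suitable local optimum. In the second case `Z` and `m` witnesses for
each of its at most `t - 1` vertices suffice. In the first case the fibre is one vertex plus a part
of `U \ T`. Restoring that vertex costs one exponential (`helly_of_erase`), hence one level of the
tower per root. -/

namespace KtHitting

/-! ### Helly numbers for minimum hitting sets, and the effect of deleting vertices -/

section Helly

variable {V : Type*}

/-- `S` meets every member of `A`. -/
def Meets (A : Finset (Finset V)) (S : Finset V) : Prop :=
  ∀ Z ∈ A, ∃ v ∈ Z, v ∈ S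

/-- `S` meets every `t`-clique of `G[W]`. -/
def CliqueHits (G : SimpleGraph V) (t : ℕ) (W S : Finset V) : Prop :=
  ∀ K : Finset V, K ⊆ W → G.IsNClique t K → ∃ v ∈ K, v ∈ S

/-- No set of at most `k` vertices meets every `t`-clique of `G[W]` and every member of `A`. -/
def Blocks (G : SimpleGraph V) (t : ℕ) (W : Finset V) (k : ℕ) (A : Finset (Finset V)) : Prop :=
  ∀ S : Finset V, CliqueHits G t W S → Meets A S → k < S.card

/-- `A` consists of (possibly empty) cliques of `G[W]` with at most `t - 1` vertices. -/
def IsCliqueFamilyOn (G : SimpleGraph V) (t : ℕ) (W : Finset V) (A : Finset (Finset V)) : Prop :=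
  ∀ Z ∈ A, Z ⊆ W ∧ Z.card ≤ t - 1 ∧ G.IsClique (Z : Set V)

/-- `k` is at most the minimum size of a `K_t`-hitting set of `G[W]`. -/
def LeOpt (G : SimpleGraph V) (t : ℕ) (W : Finset V) (k : ℕ) : Prop :=
  ∀ S : Finset V, CliqueHits G t W S → k ≤ S.card

/-- Every family of small cliques of `G[W]` that is not met by a minimum `K_t`-hitting set has a
subfamily of at most `m` members with the same property. -/
def Helly (G : SimpleGraph V) (t m : ℕ) (W : Finset V) : Prop :=
  ∀ (k : ℕ) (A : Finset (Finset V)), LeOpt G t W k → IsCliqueFamilyOn G t W A →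
    Blocks G t W k A → ∃ A₀ ⊆ A, A₀.card ≤ m ∧ Blocks G t W k A₀

/-- The variant of `Helly` for the minimum `K_t`-hitting sets that contain `v`. -/
def PinnedHelly (G : SimpleGraph V) (t m : ℕ) (W : Finset V) (v : V) : Prop :=
  ∀ (k : ℕ) (A : Finset (Finset V)), LeOpt G t W k → IsCliqueFamilyOn G t W A →
    (∀ S : Finset V, v ∈ S → CliqueHits G t W S → Meets A S → k < S.card) →
    ∃ A₀ ⊆ A, A₀.card ≤ m ∧
      ∀ S : Finset V, v ∈ S → CliqueHits G t W S → Meets A₀ S → k < S.card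

variable {G : SimpleGraph V} {t m M : ℕ} {W : Finset V}

theorem Meets.mono {A B : Finset (Finset V)} {S : Finset V} (h : Meets B S) (hAB : A ⊆ B) :
    Meets A S := fun Z hZ => h Z (hAB hZ)

theorem CliqueHits.mono {W' S : Finset V} (h : CliqueHits G t W S) (hW : W' ⊆ W) :
    CliqueHits G t W' S := fun K hK => h K (hK.trans hW)

theorem Helly.mono (h : Helly G t m W) (hm : m ≤ M) : Helly G t M W := by
  intro k A hk hA hb
  obtain ⟨A₀, h1, h2, h3⟩ := h k A hk hA hb
  exact ⟨A₀, h1, h2.trans hm, h3⟩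

theorem helly_empty (ht : 1 ≤ t) (hm : 1 ≤ m) : Helly G t m ∅ := by
  classical
  intro k A hk hA hb
  have hk0 : k = 0 := by
    have := hk ∅ fun K hK hc => by
      have := hc.card_eq
      rw [Finset.subset_empty.mp hK] at this
      simp at this
      omega
    simpa using this
  -- The only clique on no vertices is `∅`, so `A` has at most one member.
  refine ⟨A, subset_rfl, ?_, hb⟩
  refine (Finset.card_le_one.mpr fun a ha b hb' => ?_).trans hm
  rw [Finset.subset_empty.mp (hA a ha).1, Finset.subset_empty.mp (hA b hb').1]

/-- Lifts a blocking subfamily of the traces on `W.erase v` back to the original family without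
increasing its size. -/
theorem exists_subset_image_card_le {α β : Type*} [DecidableEq β] (g : α → β) (A : Finset α)
    (B : Finset β) (hB : B ⊆ A.image g) : ∃ A₀ ⊆ A, A₀.image g = B ∧ A₀.card ≤ B.card := by
  classical
  have h : ∀ b : B, ∃ a ∈ A, g a = b := fun b => Finset.mem_image.mp (hB b.2)
  choose c hc1 hc2 using h
  refine ⟨B.attach.image c, ?_, ?_, ?_⟩
  · intro a ha
    obtain ⟨b, -, rfl⟩ := Finset.mem_image.mp ha
    exact hc1 b
  · ext b
    simp only [Finset.mem_image, Finset.mem_attach, true_and, Subtype.exists]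
    constructor
    · rintro ⟨_, ⟨b', hb', rfl⟩, rfl⟩
      rw [hc2]
      exact hb'
    · intro hb
      exact ⟨_, ⟨b, hb, rfl⟩, hc2 ⟨b, hb⟩⟩
  · exact Finset.card_image_le.trans (by simp)

open Classical in
theorem IsCliqueFamilyOn.image_erase {A : Finset (Finset V)} (hA : IsCliqueFamilyOn G t W A)
    (v : V) : IsCliqueFamilyOn G t (W.erase v) (A.image fun Z => Z.erase v) := by
  intro Z hZ
  obtain ⟨Y, hY, rfl⟩ := Finset.mem_image.mp hZ
  obtain ⟨h1, h2, h3⟩ := hA Y hY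
  exact ⟨Finset.erase_subset_erase _ h1, (Finset.card_le_card (Finset.erase_subset _ _)).trans h2,
    h3.subset (by simp)⟩

open Classical in
theorem Meets.of_image_erase {A : Finset (Finset V)} {S : Finset V} {v : V}
    (h : Meets (A.image fun Z => Z.erase v) S) : Meets A S := by
  intro Z hZ
  obtain ⟨x, hx, hxS⟩ := h _ (Finset.mem_image_of_mem _ hZ)
  exact ⟨x, Finset.mem_of_mem_erase hx, hxS⟩

open Classical in
theorem Meets.image_erase {A : Finset (Finset V)} {S : Finset V} {v : V}
    (h : Meets A S) (hv : v ∉ S) : Meets (A.image fun Z => Z.erase v) S := by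
  intro Z hZ
  obtain ⟨Y, hY, rfl⟩ := Finset.mem_image.mp hZ
  obtain ⟨x, hx, hxS⟩ := h Y hY
  exact ⟨x, Finset.mem_erase.mpr ⟨fun h => hv (h ▸ hxS), hx⟩, hxS⟩

-- A hitting set that uses `v` wastes it: removing `v` leaves a hitting set, so its size already
-- exceeds `k`. A set avoiding `v` meets a clique exactly when it meets the trace on `W.erase v`.
open Classical in
theorem helly_of_erase_nonKtVertex {v : V} (hv : ∀ K ⊆ W, G.IsNClique t K → v ∉ K)
    (h : Helly G t m (W.erase v)) : Helly G t m W := by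
  intro k A hk hA hb
  have hits : ∀ {S}, CliqueHits G t (W.erase v) S → CliqueHits G t W S := by
    intro S hS K hK hc
    exact hS K (Finset.subset_erase.mpr ⟨hK, hv K hK hc⟩) hc
  obtain ⟨B, hB, hBm, hBb⟩ := h k (A.image fun Z => Z.erase v) (fun S hS => hk S (hits hS))
    (hA.image_erase v) (fun S hS hm => hb S (hits hS) hm.of_image_erase)
  obtain ⟨A₀, hA₀, rfl, hcard⟩ := exists_subset_image_card_le _ _ _ hB
  refine ⟨A₀, hA₀, hcard.trans hBm, fun S hS hm => ?_⟩
  by_cases hvS : v ∈ S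
  · have : CliqueHits G t W (S.erase v) := by
      intro K hK hc
      obtain ⟨x, hx, hxS⟩ := hS K hK hc
      exact ⟨x, hx, Finset.mem_erase.mpr ⟨fun h => hv K hK hc (h ▸ hx), hxS⟩⟩
    have h1 := hk _ this
    have h2 := Finset.card_erase_lt_of_mem hvS
    omega
  · exact hBb S (hS.mono (Finset.erase_subset _ _)) (hm.image_erase hvS)

open Classical in
theorem CliqueHits.union_of_sdiff {S X : Finset V} (h : CliqueHits G t (W \ X) S) :
    CliqueHits G t W (S ∪ X) := by
  intro K hK hc
  by_cases hd : ∃ x ∈ K, x ∈ X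
  · obtain ⟨x, hx, hxX⟩ := hd
    exact ⟨x, hx, Finset.mem_union_right _ hxX⟩
  · push Not at hd
    obtain ⟨x, hx, hxS⟩ := h K (fun x hx => Finset.mem_sdiff.mpr ⟨hK hx, hd x hx⟩) hc
    exact ⟨x, hx, Finset.mem_union_left _ hxS⟩

open Classical in
theorem CliqueHits.sdiff {S : Finset V} (h : CliqueHits G t W S) (X : Finset V) :
    CliqueHits G t (W \ X) (S \ X) := by
  intro K hK hc
  obtain ⟨x, hx, hxS⟩ := h K (hK.trans Finset.sdiff_subset) hc
  exact ⟨x, hx, Finset.mem_sdiff.mpr ⟨hxS, (Finset.mem_sdiff.mp (hK hx)).2⟩⟩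

open Classical in
/-- Fixing a part `X` of the hitting set reduces to `G[W] - X`. -/
theorem Helly.exists_blocks_superset {X : Finset V} {k : ℕ} {A : Finset (Finset V)}
    (h : Helly G t m (W \ X)) (hk : LeOpt G t (W \ X) (k - X.card))
    (hA : IsCliqueFamilyOn G t W A)
    (hb : ∀ S : Finset V, X ⊆ S → CliqueHits G t W S → Meets A S → k < S.card) :
    ∃ A₀ ⊆ A, A₀.card ≤ m ∧
      ∀ S : Finset V, X ⊆ S → CliqueHits G t W S → Meets A₀ S → k < S.card := by
  -- This case is split off so that `k - X.card` below is a true subtraction.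
  by_cases hXk : k < X.card
  · exact ⟨∅, by simp, by simp, fun S hS _ _ => hXk.trans_le (Finset.card_le_card hS)⟩
  push Not at hXk
  obtain ⟨A₀, h1, h2, h3⟩ := h (k - X.card) (A.filter fun Z => Disjoint Z X) hk
    (fun Z hZ => by
      obtain ⟨hZ, hd⟩ := Finset.mem_filter.mp hZ
      exact ⟨Finset.subset_sdiff.mpr ⟨(hA Z hZ).1, hd⟩, (hA Z hZ).2⟩)
    (fun S hS hm => by
      have hlt := hb (S ∪ X) Finset.subset_union_right hS.union_of_sdiff fun Z hZ => by
        by_cases hd : Disjoint Z X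
        · obtain ⟨x, hx, hxS⟩ := hm Z (Finset.mem_filter.mpr ⟨hZ, hd⟩)
          exact ⟨x, hx, Finset.mem_union_left _ hxS⟩
        · obtain ⟨x, hx, hxX⟩ := Finset.not_disjoint_iff.mp hd
          exact ⟨x, hx, Finset.mem_union_right _ hxX⟩
      have := Finset.card_union_le S X
      omega)
  refine ⟨A₀, h1.trans (Finset.filter_subset _ _), h2, fun S hXS hS hm => ?_⟩
  have hlt := h3 (S \ X) (hS.sdiff X) fun Z hZ => by
    obtain ⟨x, hx, hxS⟩ := hm Z hZ
    have hd := (Finset.mem_filter.mp (h1 hZ)).2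
    exact ⟨x, hx, Finset.mem_sdiff.mpr ⟨hxS, Finset.disjoint_left.mp hd hx⟩⟩
  have := Finset.card_sdiff_add_card_eq_card hXS
  omega

open Classical in
theorem pinnedHelly_of_erase {v : V} (h : Helly G t m (W.erase v)) : PinnedHelly G t m W v := by
  intro k A hk hA hb
  rw [← Finset.sdiff_singleton_eq_erase] at h
  obtain ⟨A₀, h1, h2, h3⟩ := h.exists_blocks_superset (k := k) (fun S hS => by
      have h1 := hk _ hS.union_of_sdiff
      have h2 := Finset.card_union_le S {v}
      rw [Finset.card_singleton] at *
      omega) hA (fun S hS => hb S (Finset.singleton_subset_iff.mp hS))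
  exact ⟨A₀, h1, h2, fun S hS => h3 S (Finset.singleton_subset_iff.mpr hS)⟩

open Classical in
/-- The Helly property with one vertex of slack: the hitting sets considered may exceed the optimum
by one. A subfamily `B` that blocks the optimum is met in one of at most `2 ^ ((t - 1) * m)` ways,
and after any of them no slack is left. -/
theorem exists_blocks_of_slack (h : ∀ W' ⊆ W, Helly G t m W') {k : ℕ} {A : Finset (Finset V)}
    (hk : LeOpt G t W (k - 1)) (hA : IsCliqueFamilyOn G t W A) (hb : Blocks G t W k A) :
    ∃ A₀ ⊆ A, A₀.card ≤ m + 2 ^ ((t - 1) * m) * m ∧ Blocks G t W k A₀ := by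
  obtain ⟨B, hB, hBm, hBb⟩ := h W subset_rfl (k - 1) A hk hA
    fun S hS hm => (Nat.sub_le _ _).trans_lt (hb S hS hm)
  set Y := B.biUnion id with hY
  have hYcard : Y.card ≤ (t - 1) * m :=
    (Finset.card_biUnion_le_card_mul _ _ _ fun Z hZ => (hA Z (hB hZ)).2.1).trans
      (by rw [mul_comm]; exact Nat.mul_le_mul_left _ hBm)
  have key : ∀ X : Finset V, ∃ A₀ ⊆ A, A₀.card ≤ m ∧ (Meets B X →
      ∀ S : Finset V, X ⊆ S → CliqueHits G t W S → Meets A₀ S → k < S.card) := by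
    intro X
    by_cases hX : Meets B X
    -- Since `X` meets `B`, adding `X` to a hitting set of `G[W] - X` gives at least `k` vertices.
    -- So `k - X.card` is at most the optimum there.
    · obtain ⟨A₀, h1, h2, h3⟩ := (h (W \ X) Finset.sdiff_subset).exists_blocks_superset (k := k)
        (fun S hS => by
          have hlt := hBb _ hS.union_of_sdiff fun Z hZ => by
            obtain ⟨x, hx, hxX⟩ := hX Z hZ
            exact ⟨x, hx, Finset.mem_union_right _ hxX⟩
          have := Finset.card_union_le S X
          omega) hA (fun S _ => hb S)
      exact ⟨A₀, h1, h2, fun _ => h3⟩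
    · exact ⟨∅, by simp, by simp, fun h => absurd h hX⟩
  choose a ha1 ha2 ha3 using key
  refine ⟨B ∪ Y.powerset.biUnion a, ?_, ?_, fun S hS hm => ?_⟩
  · exact Finset.union_subset hB (Finset.biUnion_subset.mpr fun X _ => ha1 X)
  · refine (Finset.card_union_le _ _).trans (Nat.add_le_add hBm ?_)
    refine (Finset.card_biUnion_le_card_mul _ _ _ fun X _ => ha2 X).trans ?_
    rw [Finset.card_powerset]
    exact Nat.mul_le_mul_right _ (Nat.pow_le_pow_right (by norm_num) hYcard)
  -- The trace of `S` on `Y` is one of the sets `X` provided for.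
  · refine ha3 (S ∩ Y) (fun Z hZ => ?_) S Finset.inter_subset_left hS
      (hm.mono ((Finset.subset_biUnion_of_mem a
        (Finset.mem_powerset.mpr Finset.inter_subset_right)).trans Finset.subset_union_right))
    obtain ⟨x, hx, hxS⟩ := hm Z (Finset.mem_union_left _ hZ)
    exact ⟨x, hx, Finset.mem_inter.mpr ⟨hxS, Finset.mem_biUnion.mpr ⟨Z, hZ, hx⟩⟩⟩

-- Sets containing `v` are handled by `m` members via the pinned version. Sets avoiding `v` must hit
-- `G[W] - v` and the link of `v`; deleting `v` may lower the optimum by one, which is the slack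
-- allowed in `exists_blocks_of_slack`.
open Classical in
theorem helly_of_erase {v : V} (h : ∀ W' ⊆ W.erase v, Helly G t m W') :
    Helly G t (m + (m + 2 ^ ((t - 1) * m) * m)) W := by
  intro k A hk hA hb
  obtain ⟨A₁, h11, h12, h13⟩ :=
    pinnedHelly_of_erase (h _ subset_rfl) k A hk hA (fun S _ => hb S)
  set L := (W.powerset.filter fun K => G.IsNClique t K ∧ v ∈ K).image fun K => K.erase v with hL
  have hits : ∀ {S}, CliqueHits G t (W.erase v) S → Meets L S → CliqueHits G t W S := by
    intro S hS hm K hK hc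
    by_cases hvK : v ∈ K
    · obtain ⟨x, hx, hxS⟩ := hm (K.erase v) (Finset.mem_image_of_mem _
        (Finset.mem_filter.mpr ⟨Finset.mem_powerset.mpr hK, hc, hvK⟩))
      exact ⟨x, Finset.mem_of_mem_erase hx, hxS⟩
    · exact hS K (Finset.subset_erase.mpr ⟨hK, hvK⟩) hc
  obtain ⟨B, hB, hBm, hBb⟩ := exists_blocks_of_slack (k := k)
    (A := A.image (fun Z => Z.erase v) ∪ L) h
    (fun S hS => by
      rw [← Finset.sdiff_singleton_eq_erase] at hS
      have h1 := hk _ hS.union_of_sdiff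
      have h2 := Finset.card_union_le S {v}
      rw [Finset.card_singleton] at h2
      omega)
    (fun Z hZ => by
      rcases Finset.mem_union.mp hZ with hZ | hZ
      · exact hA.image_erase v Z hZ
      · obtain ⟨K, hK, rfl⟩ := Finset.mem_image.mp hZ
        obtain ⟨hKW, hc, hvK⟩ := Finset.mem_filter.mp hK
        refine ⟨Finset.erase_subset_erase _ (Finset.mem_powerset.mp hKW), ?_,
          hc.isClique.subset (by simp)⟩
        rw [Finset.card_erase_of_mem hvK, hc.card_eq])
    (fun S hS hm => hb S (hits hS (hm.mono Finset.subset_union_right))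
      (hm.mono Finset.subset_union_left).of_image_erase)
  -- Link members of `B` need no representative in `A`: a hitting set of `G[W]` avoiding `v` meets
  -- them automatically.
  obtain ⟨A₂, h21, h22, h23⟩ := exists_subset_image_card_le (fun Z : Finset V => Z.erase v) A
    (B ∩ A.image fun Z => Z.erase v) Finset.inter_subset_right
  refine ⟨A₁ ∪ A₂, Finset.union_subset h11 h21, ?_, fun S hS hm => ?_⟩
  · have h1 := Finset.card_union_le A₁ A₂
    have h2 : (B ∩ A.image fun Z => Z.erase v).card ≤ B.card :=
      Finset.card_le_card Finset.inter_subset_left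
    omega
  · by_cases hvS : v ∈ S
    · exact h13 S hvS hS (hm.mono Finset.subset_union_left)
    · refine hBb S (hS.mono (Finset.erase_subset _ _)) fun Z hZ => ?_
      rcases Finset.mem_union.mp (hB hZ) with hZ' | hZ'
      · have := (hm.mono Finset.subset_union_right).image_erase hvS
        rw [h22] at this
        exact this Z (Finset.mem_inter.mpr ⟨hZ, hZ'⟩)
      · obtain ⟨K, hK, rfl⟩ := Finset.mem_image.mp hZ'
        obtain ⟨hKW, hc, -⟩ := Finset.mem_filter.mp hK
        obtain ⟨x, hx, hxS⟩ := hS K (Finset.mem_powerset.mp hKW) hc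
        exact ⟨x, Finset.mem_erase.mpr ⟨fun h => hvS (h ▸ hxS), hx⟩, hxS⟩

/-! ### Gluing local optima -/

theorem exists_minimum_cliqueHits (G : SimpleGraph V) (ht : 1 ≤ t) (W : Finset V) :
    ∃ S : Finset V, CliqueHits G t W S ∧ LeOpt G t W S.card := by
  classical
  have hex : ∃ n, ∃ S : Finset V, CliqueHits G t W S ∧ S.card = n := by
    refine ⟨_, W, fun K hK hc => ?_, rfl⟩
    obtain ⟨x, hx⟩ := Finset.card_pos.mp (hc.card_eq ▸ ht)
    exact ⟨x, hx, hK hx⟩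
  obtain ⟨S, hS, hc⟩ := Nat.find_spec hex
  exact ⟨S, hS, fun S' hS' => hc ▸ Nat.find_min' hex ⟨S', hS', rfl⟩⟩

open Classical in
/-- Gluing along the fibres of a labelling `f` that is constant along the edges of `G[W]` outside
the `K_t`-free vertex set `T`, and is the identity on `T`. -/
theorem helly_of_fibers (ht : 1 ≤ t) (T : Finset V) (f : V → V)
    (hT : ∀ v ∈ T, f v = v)
    (hadj : ∀ x ∈ W, ∀ y ∈ W, G.Adj x y → x ∉ T → f y = f x)
    (hfree : ∀ K ⊆ T, ¬ G.IsNClique t K)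
    (hM : 1 + (t - 1) * m ≤ M)
    (h1 : ∀ i, Helly G t M (W.filter fun x => f x = i))
    (h2 : ∀ v ∈ T, PinnedHelly G t m (W.filter fun x => f x = v) v) : Helly G t M W := by
  intro k A hk hA hb
  -- If the optimum exceeds `k`, the empty subfamily blocks; henceforth `k` is the optimum.
  by_cases hlt : LeOpt G t W (k + 1)
  · exact ⟨∅, by simp, by simp, fun S hS _ => hlt S hS⟩
  obtain ⟨S', hS', hS'k⟩ : ∃ S, CliqueHits G t W S ∧ S.card ≤ k := by
    simp only [LeOpt, not_forall] at hlt
    obtain ⟨S, hS, h⟩ := hlt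
    exact ⟨S, hS, by omega⟩
  set P : V → Finset V := fun i => W.filter fun x => f x = i with hP
  have hPW : ∀ i, P i ⊆ W := fun i => Finset.filter_subset _ _
  set I := W.image f with hI
  have mono_or : ∀ Z ⊆ W, G.IsClique (Z : Set V) → Z ⊆ T ∨ ∃ i ∈ I, Z ⊆ P i := by
    intro Z hZ hc
    by_cases hZT : Z ⊆ T
    · exact Or.inl hZT
    · obtain ⟨w, hw, hwT⟩ := Finset.not_subset.mp hZT
      refine Or.inr ⟨f w, Finset.mem_image_of_mem _ (hZ hw), fun x hx => ?_⟩
      refine Finset.mem_filter.mpr ⟨hZ hx, ?_⟩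
      by_cases hxw : x = w
      · rw [hxw]
      · exact hadj w (hZ hw) x (hZ hx) (hc hw hx (Ne.symm hxw)) hwT
  have glue : ∀ s : V → Finset V, (∀ i ∈ I, CliqueHits G t (P i) (s i)) →
      CliqueHits G t W (I.biUnion s) := by
    intro s hs K hK hc
    rcases mono_or K hK hc.isClique with h | ⟨i, hi, h⟩
    · exact absurd hc (hfree K h)
    · obtain ⟨x, hx, hxs⟩ := hs i hi K h hc
      exact ⟨x, hx, Finset.mem_biUnion.mpr ⟨i, hi, hxs⟩⟩
  choose s₀ hs₀ hs₀' using fun i => exists_minimum_cliqueHits G ht (P i)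
  have local_hits : ∀ {S} i, CliqueHits G t W S → CliqueHits G t (P i) (S ∩ P i) := by
    intro S i hS K hK hc
    obtain ⟨x, hx, hxS⟩ := hS K (hK.trans (hPW i)) hc
    exact ⟨x, hx, Finset.mem_inter.mpr ⟨hxS, hK hx⟩⟩
  have sum_le : ∀ S : Finset V, ∑ i ∈ I, (S ∩ P i).card ≤ S.card := by
    intro S
    have h := Finset.card_eq_sum_card_fiberwise (s := S ∩ W) (t := I) (f := f)
      (fun x hx => Finset.mem_image_of_mem _ (Finset.mem_inter.mp hx).2)
    have hle : (S ∩ W).card ≤ S.card := Finset.card_le_card Finset.inter_subset_left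
    refine le_trans (le_of_eq ?_) hle
    rw [h]
    refine Finset.sum_congr rfl fun i _ => ?_
    congr 1
    ext x
    simp [hP, and_assoc]
  -- The optimum is additive over the fibres, so exceeding the local optimum in one fibre already
  -- exceeds `k`.
  have hκ : ∑ i ∈ I, (s₀ i).card = k := by
    apply le_antisymm
    · exact (Finset.sum_le_sum fun i _ => hs₀' i _ (local_hits i hS')).trans
        ((sum_le S').trans hS'k)
    · exact (hk _ (glue s₀ fun i _ => hs₀ i)).trans Finset.card_biUnion_le
  have lift_lt : ∀ {S} i, i ∈ I → CliqueHits G t W S → (s₀ i).card < (S ∩ P i).card →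
      k < S.card := by
    intro S i hi hS hlt
    rw [← hκ]
    exact (Finset.sum_lt_sum (fun j _ => hs₀' j _ (local_hits j hS)) ⟨i, hi, hlt⟩).trans_le
      (sum_le S)
  have meets_inter : ∀ {S} i {B : Finset (Finset V)}, B ⊆ A.filter (fun Z => Z ⊆ P i) →
      Meets B S → Meets B (S ∩ P i) := by
    intro S i B hB hm Z hZ
    obtain ⟨x, hx, hxS⟩ := hm Z hZ
    exact ⟨x, hx, Finset.mem_inter.mpr ⟨hxS, (Finset.mem_filter.mp (hB hZ)).2 hx⟩⟩
  have hfam : ∀ i, IsCliqueFamilyOn G t (P i) (A.filter fun Z => Z ⊆ P i) := by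
    intro i Z hZ
    obtain ⟨hZ, hZP⟩ := Finset.mem_filter.mp hZ
    exact ⟨hZP, (hA Z hZ).2⟩
  by_cases hloc : ∃ i ∈ I, Blocks G t (P i) (s₀ i).card (A.filter fun Z => Z ⊆ P i)
  · obtain ⟨i, hi, hbi⟩ := hloc
    obtain ⟨A₀, h3, h4, h5⟩ := h1 i _ _ (hs₀' i) (hfam i) hbi
    exact ⟨A₀, h3.trans (Finset.filter_subset _ _), h4, fun S hS hm =>
      lift_lt i hi hS (h5 _ (local_hits i hS) (meets_inter i h3 hm))⟩
  -- In each fibre, take a local optimum meeting the local family, containing the label `i` whenever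
  -- this is possible.
  have hgood : ∀ i, ∃ S : Finset V, i ∈ I → (CliqueHits G t (P i) S ∧
      Meets (A.filter fun Z => Z ⊆ P i) S ∧ S.card ≤ (s₀ i).card ∧
      (i ∉ S → ∀ S' : Finset V, i ∈ S' → CliqueHits G t (P i) S' →
        Meets (A.filter fun Z => Z ⊆ P i) S' → (s₀ i).card < S'.card)) := by
    intro i
    by_cases hi : i ∈ I
    swap
    · exact ⟨∅, fun h => absurd h hi⟩
    by_cases hpin : ∃ S' : Finset V, i ∈ S' ∧ CliqueHits G t (P i) S' ∧
        Meets (A.filter fun Z => Z ⊆ P i) S' ∧ S'.card ≤ (s₀ i).card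
    · obtain ⟨S, hiS, hS⟩ := hpin
      exact ⟨S, fun _ => ⟨hS.1, hS.2.1, hS.2.2, fun h => absurd hiS h⟩⟩
    · have hn : ¬ Blocks G t (P i) (s₀ i).card (A.filter fun Z => Z ⊆ P i) :=
        fun h => hloc ⟨i, hi, h⟩
      simp only [Blocks, not_forall] at hn
      obtain ⟨S, hS, hm, hc⟩ := hn
      refine ⟨S, fun _ => ⟨hS, hm, not_lt.mp hc, fun _ S' hi' hS' hm' => ?_⟩⟩
      by_contra hle
      exact hpin ⟨S', hi', hS', hm', not_lt.mp hle⟩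
  choose s hs using hgood
  have hcard : (I.biUnion s).card ≤ k :=
    Finset.card_biUnion_le.trans (hκ ▸ Finset.sum_le_sum fun i hi => (hs i hi).2.2.1)
  have hunmet : ¬ Meets A (I.biUnion s) := fun hm =>
    absurd (hb _ (glue s fun i hi => (hs i hi).1) hm) (not_lt.mpr hcard)
  simp only [Meets, not_forall] at hunmet
  obtain ⟨Z, hZ, hZs⟩ := hunmet
  -- A member inside one fibre is met by the choice of `s`, so the unmet `Z` lies in `T`.
  have hZT : Z ⊆ T := by
    rcases mono_or Z (hA Z hZ).1 (hA Z hZ).2.2 with h | ⟨i, hi, h⟩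
    · exact h
    · obtain ⟨x, hx, hxs⟩ := (hs i hi).2.1 Z (Finset.mem_filter.mpr ⟨hZ, h⟩)
      exact absurd ⟨x, hx, Finset.mem_biUnion.mpr ⟨i, hi, hxs⟩⟩ hZs
  have hZI : ∀ v ∈ Z, v ∈ I := fun v hv =>
    hT v (hZT hv) ▸ Finset.mem_image_of_mem f ((hA Z hZ).1 hv)
  have hpin : ∀ v, ∃ A₀ ⊆ A.filter (fun Z => Z ⊆ P v), A₀.card ≤ m ∧ (v ∈ Z →
      ∀ S : Finset V, v ∈ S → CliqueHits G t (P v) S → Meets A₀ S → (s₀ v).card < S.card) := by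
    intro v
    by_cases hv : v ∈ Z
    · obtain ⟨A₀, h3, h4, h5⟩ := h2 v (hZT hv) _ _ (hs₀' v) (hfam v)
        ((hs v (hZI v hv)).2.2.2 fun h =>
          hZs ⟨v, hv, Finset.mem_biUnion.mpr ⟨v, hZI v hv, h⟩⟩)
      exact ⟨A₀, h3, h4, fun _ => h5⟩
    · exact ⟨∅, by simp, by simp, fun h => absurd h hv⟩
  choose a ha1 ha2 ha3 using hpin
  refine ⟨insert Z (Z.biUnion a), ?_, ?_, fun S hS hm => ?_⟩
  · exact Finset.insert_subset hZ (Finset.biUnion_subset.mpr fun v _ =>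
      (ha1 v).trans (Finset.filter_subset _ _))
  · have h3 := Finset.card_insert_le Z (Z.biUnion a)
    have h4 := Finset.card_biUnion_le_card_mul Z a m fun v _ => ha2 v
    have h5 := Nat.mul_le_mul_right m (hA Z hZ).2.1
    omega
  · obtain ⟨v, hv, hvS⟩ := hm Z (Finset.mem_insert_self _ _)
    have hvP : v ∈ P v := Finset.mem_filter.mpr ⟨(hA Z hZ).1 hv, hT v (hZT hv)⟩
    exact lift_lt v (hZI v hv) hS (ha3 v hv _ (Finset.mem_inter.mpr ⟨hvS, hvP⟩)
      (local_hits v hS) (meets_inter v (ha1 v) (hm.mono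
        ((Finset.subset_biUnion_of_mem a hv).trans (Finset.subset_insert _ _)))))

end Helly

/-! ### Arithmetic of the tower -/

section Tower

theorem one_le_beta (x t : ℕ) : 1 ≤ beta x t := by
  cases x with
  | zero => exact le_rfl
  | succ x => exact Nat.one_le_two_pow

theorem beta_mono {x y t : ℕ} (ht : 3 ≤ t) (h : x ≤ y) : beta x t ≤ beta y t := by
  refine monotone_nat_of_le_succ (f := fun x => beta x t) (fun n => ?_) h
  calc beta n t ≤ 2 ^ beta n t := Nat.lt_two_pow_self.le
    _ ≤ 2 ^ (t * beta n t) :=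
      Nat.pow_le_pow_right (by norm_num) (Nat.le_mul_of_pos_left _ (by omega))

theorem one_add_mul_le_two_pow (t m : ℕ) : 1 + (t - 1) * m ≤ 2 ^ (t * m) := by
  have h1 : (t - 1) * m < 2 ^ ((t - 1) * m) := Nat.lt_two_pow_self
  have h2 : 2 ^ ((t - 1) * m) ≤ 2 ^ (t * m) :=
    Nat.pow_le_pow_right (by norm_num) (Nat.mul_le_mul_right _ (Nat.sub_le _ _))
  omega

/-- With `N = 2 ^ ((t - 1) * m)`, `t ≥ 3` gives `2 * m ≤ N`, so the left side is at most `N * (m +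
1) ≤ N * 2 ^ m`. -/
theorem slack_bound_le_two_pow {t m : ℕ} (ht : 3 ≤ t) (hm : 1 ≤ m) :
    m + (m + 2 ^ ((t - 1) * m) * m) ≤ 2 ^ (t * m) := by
  have h1 : m + 1 ≤ 2 ^ m := Nat.lt_two_pow_self
  have h2 : 2 ^ (m + 1) ≤ 2 ^ ((t - 1) * m) := by
    refine Nat.pow_le_pow_right (by norm_num) ?_
    have : 2 * m ≤ (t - 1) * m := Nat.mul_le_mul_right _ (by omega)
    omega
  have h3 : 2 ^ (t * m) = 2 ^ ((t - 1) * m) * 2 ^ m := by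
    rw [← pow_add]
    congr 1
    obtain ⟨s, rfl⟩ : ∃ s, t = s + 1 := ⟨t - 1, by omega⟩
    simp [Nat.succ_mul]
  rw [pow_succ] at h2
  rw [h3]
  have h4 := Nat.mul_le_mul_left (2 ^ ((t - 1) * m)) h1
  rw [Nat.mul_add, Nat.mul_one] at h4
  omega

end Tower

/-! ### Induction along the recursion for `bed⁺_t` -/

section Induction

variable {V : Type*} {G : SimpleGraph V} {t : ℕ} {U : Finset V}

theorem mem_compVerts {c : (G.induce (U : Set V)).ConnectedComponent} {w : V} :
    w ∈ compVerts G U c ↔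
      ∃ h : w ∈ (U : Set V), (G.induce (U : Set V)).connectedComponentMk ⟨w, h⟩ = c := by
  classical
  unfold compVerts
  rw [Finset.mem_filter]
  exact ⟨fun h => h.2, fun h => ⟨h.1, h⟩⟩

theorem connectedComponentMk_eq_of_adj {x y : V} (hx : x ∈ (U : Set V)) (hy : y ∈ (U : Set V))
    (h : G.Adj x y) : (G.induce (U : Set V)).connectedComponentMk ⟨x, hx⟩ =
      (G.induce (U : Set V)).connectedComponentMk ⟨y, hy⟩ :=
  SimpleGraph.ConnectedComponent.sound
    (SimpleGraph.Adj.reachable (by simpa using h))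

-- Gluing with `T = ∅`: vertices are labelled by a representative of their component, and the second
-- case of the gluing argument needs just one member. So taking components does not increase the
-- Helly number.
open Classical in
theorem helly_of_components {m : ℕ} (ht : 1 ≤ t) (hm : 1 ≤ m)
    (h : ∀ c, ∀ W ⊆ compVerts G U c, Helly G t m W) {W : Finset V} (hW : W ⊆ U) :
    Helly G t m W := by
  let f : V → V := fun w => if hw : w ∈ (U : Set V) then
    (Quot.out ((G.induce (U : Set V)).connectedComponentMk ⟨w, hw⟩)).1 else w
  refine helly_of_fibers (m := 0) ht ∅ f (by simp) ?_ ?_ (by omega) (fun i => ?_) (by simp)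
  · intro x hx y hy hxy _
    have hx' : x ∈ (U : Set V) := hW hx
    have hy' : y ∈ (U : Set V) := hW hy
    simp only [f, dif_pos hx', dif_pos hy', connectedComponentMk_eq_of_adj hx' hy' hxy]
  · intro K hK hc
    have := hc.card_eq
    rw [Finset.subset_empty.mp hK, Finset.card_empty] at this
    omega
  · rcases (W.filter fun x => f x = i).eq_empty_or_nonempty with h0 | ⟨w, hw⟩
    · rw [h0]
      exact helly_empty ht hm
    · obtain ⟨hwW, hwi⟩ := Finset.mem_filter.mp hw
      have hwU : w ∈ (U : Set V) := hW hwW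
      refine h ((G.induce (U : Set V)).connectedComponentMk ⟨w, hwU⟩) _ fun x hx => ?_
      obtain ⟨hxW, hxi⟩ := Finset.mem_filter.mp hx
      have hxU : x ∈ (U : Set V) := hW hxW
      rw [mem_compVerts]
      refine ⟨hxU, ?_⟩
      have heq := hxi.trans hwi.symm
      simp only [f, dif_pos hxU, dif_pos hwU] at heq
      have h1 := Quot.out_eq ((G.induce (U : Set V)).connectedComponentMk ⟨x, hxU⟩)
      have h2 := Quot.out_eq ((G.induce (U : Set V)).connectedComponentMk ⟨w, hwU⟩)
      rw [← h1, ← h2, Subtype.ext heq]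

open Classical in
theorem IsRoot.helly {T : Finset V} {m : ℕ} (hT : IsRoot G t U T) (ht : 3 ≤ t) (hm : 1 ≤ m)
    (h : ∀ W ⊆ U \ T, Helly G t m W) {W : Finset V} (hW : W ⊆ U) :
    Helly G t (2 ^ (t * m)) W := by
  choose g hg using fun c => Finset.card_eq_one.mp (hT.one_neighbor c)
  -- Vertices of `T` label themselves; other vertices get the attachment point of their component.
  let f : V → V := fun w => if hw : w ∈ ((U \ T : Finset V) : Set V) then
    g ((G.induce ((U \ T : Finset V) : Set V)).connectedComponentMk ⟨w, hw⟩) else w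
  have hfT : ∀ v ∈ T, f v = v := fun v hv => dif_neg (by simp [hv])
  have hsub : ∀ i, (W.filter fun x => f x = i).erase i ⊆ U \ T := by
    intro i x hx
    obtain ⟨hxi, hx⟩ := Finset.mem_erase.mp hx
    obtain ⟨hxW, hfx⟩ := Finset.mem_filter.mp hx
    exact Finset.mem_sdiff.mpr ⟨hW hxW, fun hxT => hxi ((hfT x hxT).symm.trans hfx)⟩
  refine helly_of_fibers (m := m) (by omega) T f hfT ?_ ?_ (one_add_mul_le_two_pow t m)
    (fun i => ?_) (fun v _ => pinnedHelly_of_erase (h _ (hsub v)))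
  · intro x hx y hy hxy hxT
    have hxU : x ∈ ((U \ T : Finset V) : Set V) :=
      Finset.mem_coe.mpr (Finset.mem_sdiff.mpr ⟨hW hx, hxT⟩)
    by_cases hyT : y ∈ T
    · rw [hfT y hyT]
      simp only [f, dif_pos hxU]
      rw [← Finset.mem_singleton, ← hg, Finset.mem_filter]
      exact ⟨hyT, x, mem_compVerts.mpr ⟨hxU, rfl⟩, hxy⟩
    · have hyU : y ∈ ((U \ T : Finset V) : Set V) :=
        Finset.mem_coe.mpr (Finset.mem_sdiff.mpr ⟨hW hy, hyT⟩)
      simp only [f, dif_pos hxU, dif_pos hyU, connectedComponentMk_eq_of_adj hxU hyU hxy]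
  · intro K hK hc
    refine hT.cliqueFree (K.subtype (· ∈ (T : Set V))) ?_
    rw [SimpleGraph.isNClique_iff] at hc ⊢
    refine ⟨fun x hx y hy hxy => ?_, ?_⟩
    · rw [Finset.mem_coe, Finset.mem_subtype] at hx hy
      exact hc.1 hx hy (Subtype.coe_ne_coe.mpr hxy)
    · rw [Finset.card_subtype, Finset.filter_true_of_mem fun x hx => Finset.mem_coe.mpr (hK hx)]
      exact hc.2
  · exact (helly_of_erase fun W' hW' => h W' (hW'.trans (hsub i))).mono
      (slack_bound_le_two_pow ht hm)

-- A component of `G[U] - u` not adjacent to `u` would be closed under reachability in the connected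
-- graph `G[U]`, hence contain `u`. This makes the infimum over roots an attained minimum rather
-- than the default value `0`.
open Classical in
theorem isRoot_singleton (ht : 2 ≤ t) (hconn : (G.induce (U : Set V)).Connected) {u : V}
    (hu : u ∈ U) : IsRoot G t U {u} where
  subset := by simpa using hu
  nonempty := Finset.singleton_nonempty u
  connected := by
    have : Subsingleton ((({u} : Finset V) : Set V)) := by simp
    have : Nonempty ((({u} : Finset V) : Set V)) := ⟨⟨u, by simp⟩⟩
    exact ⟨fun x y => Subsingleton.elim x y ▸ SimpleGraph.Reachable.refl x⟩
  cliqueFree := by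
    refine SimpleGraph.cliqueFree_of_card_lt ?_
    simp
    omega
  one_neighbor := by
    intro c
    rw [Finset.card_eq_one]
    refine ⟨u, Finset.filter_true_of_mem fun x hx => ?_⟩
    rw [Finset.mem_singleton.mp hx]
    by_contra hno
    push Not at hno
    have closed : ∀ x y : (U : Set V), (G.induce (U : Set V)).Reachable x y →
        x.1 ∈ compVerts G (U \ {u}) c → y.1 ∈ compVerts G (U \ {u}) c := by
      rintro x y ⟨p⟩
      induction p with
      | nil => exact id
      | @cons a b _ hab _ ih =>
        intro ha
        refine ih ?_
        have hab' : G.Adj a.1 b.1 := by simpa using hab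
        have hb : b.1 ∈ ((U \ {u} : Finset V) : Set V) := by
          refine Finset.mem_coe.mpr (Finset.mem_sdiff.mpr ⟨b.2, fun h => ?_⟩)
          rw [Finset.mem_singleton] at h
          exact hno _ ha (h ▸ hab')
        obtain ⟨ha', hac⟩ := mem_compVerts.mp ha
        exact mem_compVerts.mpr ⟨hb, hac ▸ (connectedComponentMk_eq_of_adj ha' hb hab').symm⟩
    obtain ⟨⟨w, hw⟩, rfl⟩ := c.exists_rep
    have hwU : w ∈ (U : Set V) := (Finset.mem_sdiff.mp hw).1
    have huc := closed ⟨w, hwU⟩ ⟨u, hu⟩ (hconn.preconnected _ _) (mem_compVerts.mpr ⟨hw, rfl⟩)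
    obtain ⟨h, -⟩ := mem_compVerts.mp huc
    exact (Finset.mem_sdiff.mp h).2 (Finset.mem_singleton_self u)

open Classical in
theorem helly_beta_bedPlusOn (ht : 3 ≤ t) (U : Finset V) :
    ∀ W ⊆ U, Helly G t (beta (bedPlusOn G t U) t) W := by
  induction U using Finset.strongInduction with
  | H U ih =>
    intro W hW
    by_cases hU : U = ∅
    · subst hU
      rw [Finset.subset_empty.mp hW]
      exact helly_empty (by omega) (one_le_beta _ _)
    by_cases hv : ∃ v, IsNonKtVertex G t U v
    · obtain ⟨v, hv⟩ := hv
      rw [bedPlusOn_erase G t U v hv]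
      exact helly_of_erase_nonKtVertex (v := v) (fun K hK => hv.2 K (hK.trans hW))
        (ih _ (Finset.erase_ssubset hv.1) _ (Finset.erase_subset_erase v hW))
    by_cases hc : ¬ (G.induce (U : Set V)).Connected
    · refine helly_of_components (U := U) (by omega) (one_le_beta _ _) (fun c W' hW' => ?_) hW
      refine (ih _ (compVerts_ssubset G U (Finset.nonempty_iff_ne_empty.mpr hU) hc c) W' hW').mono
        (beta_mono ht ?_)
      conv_rhs => rw [bedPlusOn, dif_neg hU, dif_neg hv, dif_pos hc]
      exact Finset.le_sup (f := fun c => bedPlusOn G t (compVerts G U c)) (Finset.mem_univ c)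
    · have hbed : bedPlusOn G t U =
          1 + ⨅ T : {T : Finset V // IsRoot G t U T}, bedPlusOn G t (U \ T.1) := by
        rw [bedPlusOn, dif_neg hU, dif_neg hv, dif_neg hc]
      obtain ⟨u, hu⟩ := Finset.nonempty_iff_ne_empty.mpr hU
      have : Nonempty {T : Finset V // IsRoot G t U T} :=
        ⟨⟨{u}, isRoot_singleton (by omega) (not_not.mp hc) hu⟩⟩
      obtain ⟨T, hT⟩ := ciInf_mem fun T : {T : Finset V // IsRoot G t U T} =>
        bedPlusOn G t (U \ T.1)
      rw [hbed, ← hT, Nat.add_comm]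
      exact T.2.helly ht (one_le_beta _ _)
        (ih _ (Finset.sdiff_ssubset T.2.subset T.2.nonempty)) hW

end Induction

/-! ### From Helly numbers to minimal blocking sets -/

section Blocking

variable {V : Type*} {G : SimpleGraph V} {t : ℕ}

theorem isSolution_iff [Fintype V] {F : Finset (Finset V)} {S : Finset V} :
    IsSolution G t F S ↔ CliqueHits G t Finset.univ S ∧ Meets F S :=
  ⟨fun h => ⟨fun K _ => h.1 K, h.2⟩, fun h => ⟨fun K => h.1 K (Finset.subset_univ K), h.2⟩⟩

theorem opt_le_card {F : Finset (Finset V)} {S : Finset V} (h : IsSolution G t F S) :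
    opt G t F ≤ S.card :=
  Nat.sInf_le ⟨S, h, rfl⟩

theorem exists_solution_card_eq_opt [Fintype V] (ht : 1 ≤ t) {F : Finset (Finset V)}
    (hF : ∀ Z ∈ F, 1 ≤ Z.card) : ∃ S, IsSolution G t F S ∧ S.card = opt G t F := by
  refine Nat.sInf_mem (s := {n | ∃ S : Finset V, IsSolution G t F S ∧ S.card = n})
    ⟨_, Finset.univ, ⟨fun K hc => ?_, fun Z hZ => ?_⟩, rfl⟩
  · obtain ⟨x, hx⟩ := Finset.card_pos.mp (hc.card_eq ▸ ht)
    exact ⟨x, hx, Finset.mem_univ x⟩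
  · obtain ⟨x, hx⟩ := Finset.card_pos.mp (hF Z hZ)
    exact ⟨x, hx, Finset.mem_univ x⟩

open Classical in
theorem mmbs_le_of_helly [Fintype V] {m : ℕ} (ht : 1 ≤ t) (h : Helly G t m Finset.univ) : mmbs G t ≤ m := by
  refine Finset.sup_le fun F hF => Finset.sup_le fun B hB => ?_
  obtain ⟨hFfam, hFopt⟩ := (Finset.mem_filter.mp hF).2
  obtain ⟨⟨hBfam, hBopt⟩, hmin⟩ := (Finset.mem_filter.mp hB).2
  have hfam : ∀ Z ∈ F ∪ B, 1 ≤ Z.card ∧ Z.card ≤ t - 1 ∧ G.IsClique (Z : Set V) := fun Z hZ =>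
    (Finset.mem_union.mp hZ).elim (hFfam Z) (hBfam Z)
  obtain ⟨A, hA, hAm, hAb⟩ := h (opt G t F) (F ∪ B)
    -- Cleanness enters here: the threshold `opt G t F` equals the `K_t`-hitting optimum.
    (fun S hS => hFopt ▸ opt_le_card (isSolution_iff.mpr ⟨hS, by simp [Meets]⟩))
    (fun Z hZ => ⟨Finset.subset_univ Z, (hfam Z hZ).2⟩)
    (fun S hS hm => hBopt.trans_le (opt_le_card (isSolution_iff.mpr ⟨hS, hm⟩)))
  refine (Finset.card_le_card fun Z hZ => ?_).trans hAm
  -- If `Z ∈ B` were not in `A`, then `A ⊆ F ∪ B.erase Z`, so `B.erase Z` would still block, against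
  -- minimality.
  by_contra hZA
  refine hmin Z hZ ⟨fun Y hY => hBfam Y (Finset.mem_of_mem_erase hY), ?_⟩
  obtain ⟨S, hS, hcard⟩ := exists_solution_card_eq_opt (G := G) ht (F := F ∪ B.erase Z)
    fun Y hY => (hfam Y (Finset.union_subset_union_right (Finset.erase_subset _ _) hY)).1
  rw [← hcard]
  obtain ⟨hS1, hS2⟩ := isSolution_iff.mp hS
  refine hAb S hS1 (hS2.mono fun Y hY => ?_)
  rcases Finset.mem_union.mp (hA hY) with hY' | hY'
  · exact Finset.mem_union_left _ hY'
  · exact Finset.mem_union_right _ (Finset.mem_erase.mpr ⟨fun h => hZA (h ▸ hY), hY'⟩)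

end Blocking

end KtHitting

theorem mainTheorem5 {V : Type*} [Fintype V] (G : SimpleGraph V) (t : ℕ) (ht : 3 ≤ t) :
    KtHitting.mmbs G t ≤ KtHitting.beta (KtHitting.bedPlus G t) t :=
  KtHitting.mmbs_le_of_helly (by omega)
    (KtHitting.helly_beta_bedPlusOn ht Finset.univ Finset.univ subset_rfl)
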